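/- Let $J\subset\mathbb R$ be a time interval with nonempty interior (open, half-open or closed, bounded or not; at an endpoint belonging to $J$, $\partial_t$ is the one-sided derivative), let $\nu\ge 0$, and let $u, A, v: \mathbb R^3\times J\to\mathbb R^3$ be vector fields, $u$ of class $C^1$ and $A, v$ of class $C^3$ on $\mathbb R^3\times J$. Summation over repeated indices is understood, $\epsilon_{ijk}$ is the totally antisymmetric symbol with $\epsilon_{123}=1$, and $(\nabla F)_{mj}=\partial_jF^m$ for a vector field $F$. Write $$\Gamma_\nu(u,\nabla)=\partial_t+u\cdot\nabla-\nu\Delta .$$ Assume that $\nabla\cdot u=0$, that $\nabla A(x,t)$ is invertible for all $(x,t)$, and put $$Q=(\nabla A)^{-1},\qquad \nabla^A_i=Q_{ji}\partial_j,\qquad \ell(x,t)=A(x,t)-x,\qquad C^m_{k;i}=\nabla^A_i(\partial_k\ell_m).$$ Assume that $A$ and $v$ solve, on $\mathbb R^3\times J$, $$\Gamma_\nu(u,\nabla)A=0,\qquad \Gamma_\nu(u,\nabla)v_i=2\nu\,C^m_{k;i}\,\partial_kv_m .$$ Let $w_i=(\partial_iA^m)v_m$ and let $\zeta=\nabla^A\times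 v$, that is, $\zeta_q=\epsilon_{qij}\nabla^A_iv_j$. Then $w$, $\nabla\times w$, $\zeta$ and $\log|\mathrm{Det}(\nabla A)|$ are of class $C^2$ on $\mathbb R^3\times J$, and on $\mathbb R^3\times J$: 1. $w$ obeys the cotangent equation $\Gamma_\nu(u,\nabla)w+(\nabla u)^*w=0$, that is, $\Gamma_\nu(u,\nabla)w_i+(\partial_iu_j)w_j=0$. 2. $\nabla\times w$ obeys $\Gamma_\nu(u,\nabla)(\nabla\times w)=(\nabla u)(\nabla\times w)$, that is, $\Gamma_\nu(u,\nabla)(\nabla\times w)_q=(\partial_ju_q)(\nabla\times w)_j$. 3. $\zeta$ obeys $$\Gamma_\nu(u,\nabla)\zeta_q=2\nu\,C^m_{k;m}\partial_k\zeta_q-2\nu\,C^q_{k;j}\partial_k\zeta_j+\nu\,C^m_{k;i}C^r_{k;j}\,\epsilon_{qji}\,\epsilon_{rmp}\,\zeta_p .$$ 4. $\nabla\times w$ and $\zeta$ are related by $$(\nabla\times w)_q=\tfrac12\,\epsilon_{qij}\,\mathrm{Det}\left[\zeta;\ \frac{\partial A}{\partial x_i};\ \frac{\partial A}{\partial x_j}\right].$$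 5. The determinant of $\nabla A$ obeys $$\Gamma_\nu(u,\nabla)\left(\log|\mathrm{Det}(\nabla A)|\right)=\nu\,C^i_{k;s}C^s_{k;i};$$ where $\mathrm{Det}(\nabla A)>0$ the left-hand side is $\Gamma_\nu(u,\nabla)(\log\mathrm{Det}(\nabla A))$. -/

import Mathlib

open scoped Laplacian ContDiff Matrix

namespace DiffusiveLagrangian

noncomputable section

/-- Three-dimensional Euclidean space. -/
abbrev E3 : Type := EuclideanSpace ℝ (Fin 3)

/-- The partial derivative `∂ₖ f` of a scalar function on space. -/
def pd (k : Fin 3) (f : E3 → ℝ) (x : E3) : ℝ :=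
  fderiv ℝ f x (EuclideanSpace.single k 1)

/-- The gradient matrix `(∇F)_{m j} = ∂ⱼ F^m` of a vector field on space. -/
def grad (F : E3 → E3) (x : E3) : Matrix (Fin 3) (Fin 3) ℝ :=
  Matrix.of fun m j => pd j (fun y => F y m) x

/-- The divergence `∂ᵢ Fᵢ`. -/
def divergence (F : E3 → E3) (x : E3) : ℝ :=
  ∑ i, pd i (fun y => F y i) x

/-- The totally antisymmetric symbol `ε_{ijk}` with `ε_{012} = 1`. -/
def eps (i j k : Fin 3) : ℝ :=
  (((j : ℕ) : ℝ) - ((i : ℕ) : ℝ)) * (((k : ℕ) : ℝ) - ((j : ℕ) : ℝ)) *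
    (((k : ℕ) : ℝ) - ((i : ℕ) : ℝ)) / 2

/-- The curl `(∇ × F)_q = ε_{qij} ∂ᵢ Fⱼ`. -/
def curl (F : E3 → E3) (x : E3) : E3 :=
  WithLp.toLp 2 fun q => ∑ i, ∑ j, eps q i j * pd i (fun y => F y j) x

/-- The operator `Γ_ν(u, ∇) = ∂ₜ + u · ∇ - ν Δ` on time-dependent scalar functions, with times in
the interval `J`; at an endpoint that belongs to `J` the time derivative is one-sided. -/
def Gam (J : Set ℝ) (ν : ℝ) (u : ℝ → E3 → E3) (f : ℝ → E3 → ℝ) (t : ℝ) (x : E3) : ℝ :=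
  derivWithin (fun s => f s x) J t + ∑ k, u t x k * pd k (f t) x - ν * (Δ (f t)) x

/-- `Q = (∇A)⁻¹`. -/
def Q (A : E3 → E3) (x : E3) : Matrix (Fin 3) (Fin 3) ℝ :=
  (grad A x)⁻¹

/-- The Eulerian-Lagrangian derivative `∇^A_i = Q_{ji} ∂ⱼ`. -/
def pdA (A : E3 → E3) (i : Fin 3) (f : E3 → ℝ) (x : E3) : ℝ :=
  ∑ j, Q A x j i * pd j f x

/-- The coefficients `C^m_{k;i} = ∇^A_i (∂ₖ ℓ_m)`, where `ℓ(x) = A(x) - x` is the displacement. -/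
def C (A : E3 → E3) (m k i : Fin 3) (x : E3) : ℝ :=
  pdA A i (pd k (fun y => (A y - y) m)) x

/-- The Eulerian-Lagrangian curl `(∇^A × v)_q = ε_{qij} ∇^A_i vⱼ`. -/
def curlA (A v : E3 → E3) (x : E3) : E3 :=
  WithLp.toLp 2 fun q => ∑ i, ∑ j, eps q i j * pdA A i (fun y => v y j) x

/-- The field `w = (∇A)^* v`, that is, `wᵢ = (∂ᵢ A^m) v_m`. -/
def weber (A v : E3 → E3) (x : E3) : E3 :=
  WithLp.toLp 2 fun i => ∑ m, pd i (fun y => A y m) x * v x m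

/-- `Det [z ; ∂A/∂xᵢ ; ∂A/∂xⱼ]`. -/
def detCauchy (A : E3 → E3) (z : E3) (i j : Fin 3) (x : E3) : ℝ :=
  Matrix.det (Matrix.of ![fun p => z p, fun p => pd i (fun y => A y p) x,
    fun p => pd j (fun y => A y p) x])

end

end DiffusiveLagrangian

/-! Two properties of `Γ` drive everything. It is a derivation up to `-2ν ∇F·∇G`, and its commutator
with `∂ⱼ` is first order: `∂ⱼ Γ F = Γ ∂ⱼ F + (∂ⱼ U)·∇F`. Hence `Γ A = 0` gives `Γ(∂ⱼ Aᵐ) = -(∂ⱼ Uₖ)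
∂ₖ Aᵐ`.

Contracted with `∂ⱼ Aⁱ`, the equation for `v` loses its inverse matrix: `∂ⱼ Aⁱ Γ vᵢ = 2ν ∂ⱼ∂ₖ Aᵐ ∂ₖ
vₘ`. This is exactly what cancels the product-rule defect in `Γ((∂ⱼ Aᵐ) vₘ)`, leaving the cotangent
equation. The curl of `w` is the antisymmetric part of `∂ᵢ vₘ ∂ⱼ Aᵐ`. Under `Γ` the diffusive terms
of this tensor are symmetric and drop out, and `div u = 0` turns the rest into stretching.

For `ζ`, the commutator of `Γ` with `∇^A_i` is `2ν C^m_{k;i} ∂ₖ ∇^A_m`. The derivatives of `C` in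
`∇^A_i Γ vⱼ` are symmetric because the `∇^A_i` commute, so they disappear on antisymmetrisation. The
Cauchy formula is the cofactor law for the antisymmetric part of `Bᵀ G B`, with `B = ∇A` and `G =
∇^A v`. The determinant equation is Jacobi's formula combined with `∂ₖ R = -R C`.

These computations use derivatives within the space-time slab along fixed directions, which treats
interior times and endpoints alike. -/

namespace DiffusiveLagrangian

noncomputable section

/-! ### Directional derivatives within a set, and the calculus of the transport operator. -/

section Calculus

variable {V : Type*} [NormedAddCommGroup V] [NormedSpace ℝ V] {S : Set V} {F G : V → ℝ} {p : V}

/-- The derivative of `F` within `S` in the direction `e`. -/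
def dirD (S : Set V) (e : V) (F : V → ℝ) (p : V) : ℝ :=
  fderivWithin ℝ F S p e

theorem dirD_congr (e : V) (h : Set.EqOn F G S) : Set.EqOn (dirD S e F) (dirD S e G) S := by
  intro p hp
  simp only [dirD, fderivWithin_congr h (h hp)]

theorem contDiffOn_dirD (hS : UniqueDiffOn ℝ S) {m n : WithTop ℕ∞} (e : V)
    (hF : ContDiffOn ℝ n F S) (hmn : m + 1 ≤ n) : ContDiffOn ℝ m (dirD S e F) S :=
  (hF.fderivWithin hS hmn).clm_apply contDiffOn_const

theorem dirD_const (e : V) (c : ℝ) : dirD S e (fun _ => c) p = 0 := by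
  simp [dirD]

theorem dirD_add (hS : UniqueDiffOn ℝ S) (e : V) (hF : ContDiffOn ℝ 1 F S)
    (hG : ContDiffOn ℝ 1 G S) (hp : p ∈ S) :
    dirD S e (fun y => F y + G y) p = dirD S e F p + dirD S e G p := by
  simp only [dirD]
  rw [fderivWithin_fun_add (hS p hp) (hF.differentiableOn one_ne_zero p hp)
    (hG.differentiableOn one_ne_zero p hp)]
  rfl

theorem dirD_mul (hS : UniqueDiffOn ℝ S) (e : V) (hF : ContDiffOn ℝ 1 F S)
    (hG : ContDiffOn ℝ 1 G S) (hp : p ∈ S) :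
    dirD S e (fun y => F y * G y) p = dirD S e F p * G p + F p * dirD S e G p := by
  simp only [dirD]
  rw [fderivWithin_fun_mul (hS p hp) (hF.differentiableOn one_ne_zero p hp)
    (hG.differentiableOn one_ne_zero p hp)]
  simp only [add_apply, smul_apply, smul_eq_mul]
  ring

theorem dirD_const_mul (hS : UniqueDiffOn ℝ S) (e : V) (c : ℝ) (hF : ContDiffOn ℝ 1 F S)
    (hp : p ∈ S) : dirD S e (fun y => c * F y) p = c * dirD S e F p := by
  rw [dirD_mul hS e contDiffOn_const hF hp, dirD_const]
  ring

theorem dirD_sum (hS : UniqueDiffOn ℝ S) (e : V) {ι : Type*} (s : Finset ι) {H : ι → V → ℝ}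
    (hH : ∀ i, ContDiffOn ℝ 1 (H i) S) (hp : p ∈ S) :
    dirD S e (fun y => ∑ i ∈ s, H i y) p = ∑ i ∈ s, dirD S e (H i) p := by
  simp only [dirD]
  rw [fderivWithin_fun_sum (hS p hp) fun i _ => (hH i).differentiableOn one_ne_zero p hp]
  simp

theorem dirD_log (hS : UniqueDiffOn ℝ S) (e : V) (hF : ContDiffOn ℝ 1 F S) (hp : p ∈ S)
    (h0 : F p ≠ 0) : dirD S e (fun y => Real.log (F y)) p = dirD S e F p / F p := by
  simp only [dirD]
  rw [fderivWithin.log (hF.differentiableOn one_ne_zero p hp) h0 (hS p hp)]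
  simp only [smul_apply, smul_eq_mul]
  ring

/-- Second derivatives within `S` are symmetric at limits of interior points; this is what covers
the endpoint times. -/
theorem dirD_comm (hS : UniqueDiffOn ℝ S) (hS' : S ⊆ closure (interior S)) (e e' : V)
    (hF : ContDiffOn ℝ 2 F S) (hp : p ∈ S) :
    dirD S e (dirD S e' F) p = dirD S e' (dirD S e F) p := by
  have hd : DifferentiableWithinAt ℝ (fderivWithin ℝ F S) S p :=
    (hF.fderivWithin (m := 1) hS (by norm_num)).differentiableOn one_ne_zero p hp
  have key : ∀ a b : V, dirD S a (dirD S b F) p =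
      fderivWithin ℝ (fderivWithin ℝ F S) S p a b := by
    intro a b
    have h := fderivWithin_clm_apply (hS p hp) hd (differentiableWithinAt_const (c := b))
    change fderivWithin ℝ (fun y => fderivWithin ℝ F S y b) S p a = _
    rw [h]
    simp
  rw [key, key]
  exact (hF p hp).isSymmSndFDerivWithinAt (by simp) hS (hS' hp) hp e e'

/-- The operator `∂₀ + U · ∇ - ν Δ` built from the derivatives along `e₀` and the `e k`. -/
def transport (S : Set V) (e₀ : V) (e : Fin 3 → V) (ν : ℝ) (U : Fin 3 → V → ℝ) (F : V → ℝ)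
    (p : V) : ℝ :=
  dirD S e₀ F p + ∑ k, U k p * dirD S (e k) F p - ν * ∑ k, dirD S (e k) (dirD S (e k) F) p

variable {e₀ : V} {e : Fin 3 → V} {ν : ℝ} {U : Fin 3 → V → ℝ}

theorem transport_congr (h : Set.EqOn F G S) :
    Set.EqOn (transport S e₀ e ν U F) (transport S e₀ e ν U G) S := by
  intro p hp
  simp only [transport, dirD_congr _ h hp, dirD_congr _ (dirD_congr _ h) hp]

theorem transport_const (c : ℝ) : transport S e₀ e ν U (fun _ => c) p = 0 := by
  have h : ∀ e : V, dirD S e (fun _ => c) = fun _ => 0 := fun e => funext fun _ => dirD_const e c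
  simp [transport, h, dirD_const]

/-- The first-order part is a derivation; the Laplacian contributes the gradient product. -/
theorem transport_mul (hS : UniqueDiffOn ℝ S) (hF : ContDiffOn ℝ 2 F S)
    (hG : ContDiffOn ℝ 2 G S) (hp : p ∈ S) :
    transport S e₀ e ν U (fun y => F y * G y) p =
      transport S e₀ e ν U F p * G p + F p * transport S e₀ e ν U G p
        - 2 * ν * ∑ k, dirD S (e k) F p * dirD S (e k) G p := by
  have hF1 := hF.of_le (m := 1) (by norm_num)
  have hG1 := hG.of_le (m := 1) (by norm_num)
  have h2 : ∀ k, dirD S (e k) (dirD S (e k) fun y => F y * G y) p =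
      dirD S (e k) (dirD S (e k) F) p * G p + 2 * (dirD S (e k) F p * dirD S (e k) G p) +
        F p * dirD S (e k) (dirD S (e k) G) p := by
    intro k
    have hF' := contDiffOn_dirD (m := 1) hS (e k) hF (by norm_num)
    have hG' := contDiffOn_dirD (m := 1) hS (e k) hG (by norm_num)
    rw [dirD_congr (e k) (fun y hy => dirD_mul hS (e k) hF1 hG1 hy) hp,
      dirD_add hS _ (hF'.mul hG1) (hF1.mul hG') hp, dirD_mul hS _ hF' hG1 hp,
      dirD_mul hS _ hF1 hG' hp]
    ring
  simp only [transport, h2, dirD_mul hS _ hF1 hG1 hp, Fin.sum_univ_three]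
  ring

theorem transport_sum (hS : UniqueDiffOn ℝ S) {ι : Type*} (s : Finset ι) {H : ι → V → ℝ}
    (hH : ∀ i, ContDiffOn ℝ 2 (H i) S) (hp : p ∈ S) :
    transport S e₀ e ν U (fun y => ∑ i ∈ s, H i y) p = ∑ i ∈ s, transport S e₀ e ν U (H i) p := by
  have h1 := fun i => (hH i).of_le (m := 1) (by norm_num)
  have h2 : ∀ k, dirD S (e k) (dirD S (e k) fun y => ∑ i ∈ s, H i y) p =
      ∑ i ∈ s, dirD S (e k) (dirD S (e k) (H i)) p := by
    intro k
    rw [dirD_congr (e k) (fun y hy => dirD_sum hS (e k) s h1 hy) hp,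
      dirD_sum hS _ s (fun i => contDiffOn_dirD hS _ (hH i) (by norm_num)) hp]
  simp only [transport, h2, dirD_sum hS _ s h1 hp, Finset.sum_sub_distrib, Finset.sum_add_distrib,
    Finset.mul_sum]
  rw [Finset.sum_comm (s := s), Finset.sum_comm (s := s)]

theorem transport_const_mul (hS : UniqueDiffOn ℝ S) (c : ℝ) (hF : ContDiffOn ℝ 2 F S)
    (hp : p ∈ S) :
    transport S e₀ e ν U (fun y => c * F y) p = c * transport S e₀ e ν U F p := by
  rw [transport_mul hS contDiffOn_const hF hp, transport_const]
  simp [dirD_const]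

theorem transport_sub (hS : UniqueDiffOn ℝ S) (hF : ContDiffOn ℝ 2 F S)
    (hG : ContDiffOn ℝ 2 G S) (hp : p ∈ S) :
    transport S e₀ e ν U (fun y => F y - G y) p =
      transport S e₀ e ν U F p - transport S e₀ e ν U G p := by
  have h := transport_sum (e₀ := e₀) (e := e) (ν := ν) (U := U) hS Finset.univ
    (H := ![F, fun y => (-1) * G y])
    (by intro i; fin_cases i; exacts [hF, contDiffOn_const.mul hG]) hp
  simp only [Fin.sum_univ_two, Matrix.cons_val_zero, Matrix.cons_val_one,
    transport_const_mul hS _ hG hp] at h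
  rw [sub_eq_add_neg, neg_eq_neg_one_mul, ← h]
  congr 1
  funext y
  ring

/-- The derivative along `e j` commutes with the transport operator up to `(∂ⱼ U) · ∇`. -/
theorem dirD_transport (hS : UniqueDiffOn ℝ S) (hS' : S ⊆ closure (interior S))
    (hU : ∀ k, ContDiffOn ℝ 1 (U k) S) (hF : ContDiffOn ℝ 3 F S) (j : Fin 3) (hp : p ∈ S) :
    dirD S (e j) (transport S e₀ e ν U F) p =
      transport S e₀ e ν U (dirD S (e j) F) p +
        ∑ k, dirD S (e j) (U k) p * dirD S (e k) F p := by
  have hF2 := hF.of_le (m := 2) (by norm_num)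
  have hD : ∀ a, ContDiffOn ℝ 2 (dirD S a F) S := fun a => contDiffOn_dirD hS a hF (by norm_num)
  have hD1 : ∀ a, ContDiffOn ℝ 1 (dirD S a F) S := fun a => (hD a).of_le (by norm_num)
  have hDD : ∀ a b, ContDiffOn ℝ 1 (dirD S a (dirD S b F)) S :=
    fun a b => contDiffOn_dirD hS a (hD b) (by norm_num)
  -- Two swaps move `e j` past both copies of `e k`; the inner swap has to hold throughout `S`,
  -- since it is differentiated again.
  have h3 : ∀ k, dirD S (e j) (dirD S (e k) (dirD S (e k) F)) p =
      dirD S (e k) (dirD S (e k) (dirD S (e j) F)) p := by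
    intro k
    rw [dirD_comm hS hS' _ _ (hD _) hp,
      dirD_congr (e k) (fun y hy => dirD_comm hS hS' (e j) (e k) hF2 hy) hp]
  have hT : Set.EqOn (transport S e₀ e ν U F) (fun y => (dirD S e₀ F y +
      ∑ k, U k y * dirD S (e k) F y) + (-ν) * ∑ k, dirD S (e k) (dirD S (e k) F) y) S := by
    intro y _
    simp only [transport]
    ring
  rw [dirD_congr (e j) hT hp, dirD_add hS _ ((hD1 _).add (.sum fun k _ => (hU k).mul (hD1 _)))
      (contDiffOn_const.mul (.sum fun k _ => hDD _ _)) hp,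
    dirD_add hS _ (hD1 _) (.sum fun k _ => (hU k).mul (hD1 _)) hp,
    dirD_const_mul hS _ _ (.sum fun k _ => hDD _ _) hp,
    dirD_sum hS _ _ (fun k => (hU k).mul (hD1 _)) hp, dirD_sum hS _ _ (fun k => hDD _ _) hp]
  simp only [h3, dirD_mul hS _ (hU _) (hD1 _) hp, transport, dirD_comm hS hS' (e j) _ hF2 hp,
    Finset.sum_add_distrib]
  ring

end Calculus

/-! ### Commutation identities and evolution equations for the tensors built from `A` and `v`. -/

section Fields

variable {V : Type*} [NormedAddCommGroup V] [NormedSpace ℝ V]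

/-- The derivatives `R_{ji} ∂ⱼ`. -/
def lagD (S : Set V) (e : Fin 3 → V) (R : Fin 3 → Fin 3 → V → ℝ) (i : Fin 3) (F : V → ℝ)
    (p : V) : ℝ :=
  ∑ j, R j i p * dirD S (e j) F p

theorem lagD_dirD (S : Set V) (e : Fin 3 → V) (R : Fin 3 → Fin 3 → V → ℝ) (i : Fin 3) (a : V)
    (F : V → ℝ) (p : V) :
    lagD S e R i (dirD S a F) p = ∑ j, R j i p * dirD S (e j) (dirD S a F) p :=
  rfl

/-- The coefficients `R_{ji} ∂ⱼ ∂ₖ Aₘ`. -/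
def conn (S : Set V) (e : Fin 3 → V) (R : Fin 3 → Fin 3 → V → ℝ) (A : Fin 3 → V → ℝ)
    (m k i : Fin 3) (p : V) : ℝ :=
  lagD S e R i (dirD S (e k) (A m)) p

/-- Diffusive Lagrangian maps `A` and virtual velocities `v`, where `R` is the inverse of the
gradient matrix of `A`. -/
structure DiffusivePair (S : Set V) (e₀ : V) (e : Fin 3 → V) (ν : ℝ) (U A v : Fin 3 → V → ℝ)
    (R : Fin 3 → Fin 3 → V → ℝ) : Prop where
  uniq : UniqueDiffOn ℝ S
  subset_closure : S ⊆ closure (interior S)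
  contDiff_U : ∀ k, ContDiffOn ℝ 1 (U k) S
  contDiff_A : ∀ m, ContDiffOn ℝ 3 (A m) S
  contDiff_v : ∀ m, ContDiffOn ℝ 3 (v m) S
  contDiff_R : ∀ i m, ContDiffOn ℝ 2 (R i m) S
  left_inv : ∀ p ∈ S, ∀ i j, ∑ m, R i m p * dirD S (e j) (A m) p = if i = j then 1 else 0
  right_inv : ∀ p ∈ S, ∀ m n, ∑ j, dirD S (e j) (A m) p * R j n p = if m = n then 1 else 0
  div_eq : ∀ p ∈ S, ∑ k, dirD S (e k) (U k) p = 0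
  eq_A : ∀ p ∈ S, ∀ m, transport S e₀ e ν U (A m) p = 0
  eq_v : ∀ p ∈ S, ∀ i, transport S e₀ e ν U (v i) p =
    2 * ν * ∑ m, ∑ k, conn S e R A m k i p * dirD S (e k) (v m) p

namespace DiffusivePair

variable {S : Set V} {e₀ : V} {e : Fin 3 → V} {ν : ℝ} {U A v : Fin 3 → V → ℝ}
  {R : Fin 3 → Fin 3 → V → ℝ} {F : V → ℝ} {p : V}

theorem contDiff_dA (h : DiffusivePair S e₀ e ν U A v R) (m j : Fin 3) :
    ContDiffOn ℝ 2 (dirD S (e j) (A m)) S :=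
  contDiffOn_dirD h.uniq _ (h.contDiff_A m) (by norm_num)

theorem contDiff_ddA (h : DiffusivePair S e₀ e ν U A v R) (m j k : Fin 3) :
    ContDiffOn ℝ 1 (dirD S (e k) (dirD S (e j) (A m))) S :=
  contDiffOn_dirD h.uniq _ (h.contDiff_dA m j) (by norm_num)

theorem contDiff_dv (h : DiffusivePair S e₀ e ν U A v R) (m j : Fin 3) :
    ContDiffOn ℝ 2 (dirD S (e j) (v m)) S :=
  contDiffOn_dirD h.uniq _ (h.contDiff_v m) (by norm_num)

theorem contDiff_conn (h : DiffusivePair S e₀ e ν U A v R) (m k i : Fin 3) :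
    ContDiffOn ℝ 1 (conn S e R A m k i) S := by
  change ContDiffOn ℝ 1 (fun y => ∑ j, R j i y * dirD S (e j) (dirD S (e k) (A m)) y) S
  exact .sum fun j _ => ((h.contDiff_R j i).of_le (by norm_num)).mul (h.contDiff_ddA m k j)

theorem ddA_comm (h : DiffusivePair S e₀ e ν U A v R) (hp : p ∈ S) (m j k : Fin 3) :
    dirD S (e k) (dirD S (e j) (A m)) p = dirD S (e j) (dirD S (e k) (A m)) p :=
  dirD_comm h.uniq h.subset_closure _ _ ((h.contDiff_A m).of_le (by norm_num)) hp

theorem ddv_comm (h : DiffusivePair S e₀ e ν U A v R) (hp : p ∈ S) (m j k : Fin 3) :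
    dirD S (e k) (dirD S (e j) (v m)) p = dirD S (e j) (dirD S (e k) (v m)) p :=
  dirD_comm h.uniq h.subset_closure _ _ ((h.contDiff_v m).of_le (by norm_num)) hp

/-- A derivative is recovered from the Eulerian-Lagrangian ones. -/
theorem sum_dA_mul_lagD (h : DiffusivePair S e₀ e ν U A v R) (hp : p ∈ S) (j : Fin 3)
    (F : V → ℝ) : ∑ m, dirD S (e j) (A m) p * lagD S e R m F p = dirD S (e j) F p := by
  simp only [lagD, Finset.mul_sum]
  rw [Finset.sum_comm]
  calc _ = ∑ l, (∑ m, R l m p * dirD S (e j) (A m) p) * dirD S (e l) F p := by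
        refine Finset.sum_congr rfl fun l _ => ?_
        rw [Finset.sum_mul]
        exact Finset.sum_congr rfl fun m _ => by ring
    _ = _ := by simp [h.left_inv p hp]

theorem sum_dA_mul_conn (h : DiffusivePair S e₀ e ν U A v R) (hp : p ∈ S) (m k j : Fin 3) :
    ∑ i, dirD S (e j) (A i) p * conn S e R A m k i p = dirD S (e j) (dirD S (e k) (A m)) p :=
  h.sum_dA_mul_lagD hp j _

/-- Contraction with `∇A` undoes the `R` inside `conn`, leaving the cross term that the product rule
produces. -/
theorem sum_dA_mul_transport_v (h : DiffusivePair S e₀ e ν U A v R) (hp : p ∈ S) (j : Fin 3) :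
    ∑ i, dirD S (e j) (A i) p * transport S e₀ e ν U (v i) p =
      2 * ν * ∑ m, ∑ k, dirD S (e j) (dirD S (e k) (A m)) p * dirD S (e k) (v m) p := by
  simp only [h.eq_v p hp, ← h.sum_dA_mul_conn hp _ _ j, Fin.sum_univ_three]
  ring

/-- Differentiate `Γ A = 0` along `e j`. -/
theorem transport_dA (h : DiffusivePair S e₀ e ν U A v R) (hp : p ∈ S) (m j : Fin 3) :
    transport S e₀ e ν U (dirD S (e j) (A m)) p =
      -∑ k, dirD S (e j) (U k) p * dirD S (e k) (A m) p := by
  have h1 := dirD_transport (e₀ := e₀) (e := e) (ν := ν) h.uniq h.subset_closure h.contDiff_U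
    (h.contDiff_A m) j hp
  rw [dirD_congr (G := fun _ => 0) (e j) (fun y hy => h.eq_A y hy m) hp, dirD_const] at h1
  linarith

theorem transport_dv (h : DiffusivePair S e₀ e ν U A v R) (hp : p ∈ S) (m j : Fin 3) :
    transport S e₀ e ν U (dirD S (e j) (v m)) p =
      dirD S (e j) (transport S e₀ e ν U (v m)) p -
        ∑ k, dirD S (e j) (U k) p * dirD S (e k) (v m) p := by
  rw [dirD_transport h.uniq h.subset_closure h.contDiff_U (h.contDiff_v m) j hp]
  ring

theorem contDiff_transport_v (h : DiffusivePair S e₀ e ν U A v R) (m : Fin 3) :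
    ContDiffOn ℝ 1 (transport S e₀ e ν U (v m)) S :=
  (contDiffOn_const.mul (.sum fun n _ => .sum fun k _ => (h.contDiff_conn n k m).mul
    ((h.contDiff_dv n k).of_le (by norm_num)))).congr fun y hy => h.eq_v y hy m

/-- The cotangent equation. -/
theorem transport_weber (h : DiffusivePair S e₀ e ν U A v R) (hp : p ∈ S) (i : Fin 3) :
    transport S e₀ e ν U (fun y => ∑ m, dirD S (e i) (A m) y * v m y) p +
      ∑ j, dirD S (e i) (U j) p * ∑ m, dirD S (e j) (A m) p * v m p = 0 := by
  have hv2 := fun m => (h.contDiff_v m).of_le (m := 2) (by norm_num)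
  rw [transport_sum h.uniq _ (fun m => (h.contDiff_dA m i).mul (hv2 m)) hp]
  have h1 := h.sum_dA_mul_transport_v hp i
  simp only [transport_mul h.uniq (h.contDiff_dA _ i) (hv2 _) hp, h.transport_dA hp]
  simp only [h.ddA_comm hp _ _ i, Fin.sum_univ_three] at h1 ⊢
  linear_combination h1

/-- The two-tensor `∂ᵢ v_m ∂ⱼ A^m`, whose antisymmetric part is the curl of `(∇A)^* v`. -/
def stretch (S : Set V) (e : Fin 3 → V) (A v : Fin 3 → V → ℝ) (i j : Fin 3) (p : V) : ℝ :=
  ∑ m, dirD S (e i) (v m) p * dirD S (e j) (A m) p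

theorem contDiff_stretch (h : DiffusivePair S e₀ e ν U A v R) (i j : Fin 3) :
    ContDiffOn ℝ 2 (stretch S e A v i j) S :=
  .sum fun m _ => (h.contDiff_dv m i).mul (h.contDiff_dA m j)

theorem dirD_weber (h : DiffusivePair S e₀ e ν U A v R) (hp : p ∈ S) (i j : Fin 3) :
    dirD S (e i) (fun y => ∑ m, dirD S (e j) (A m) y * v m y) p =
      ∑ m, dirD S (e i) (dirD S (e j) (A m)) p * v m p + stretch S e A v i j p := by
  have hv1 := fun m => (h.contDiff_v m).of_le (m := 1) (by norm_num)
  have hA1 := fun m => (h.contDiff_dA m j).of_le (m := 1) (by norm_num)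
  rw [dirD_sum h.uniq _ _ (fun m => (hA1 m).mul (hv1 m)) hp]
  simp only [dirD_mul h.uniq _ (hA1 _) (hv1 _) hp, stretch, Finset.sum_add_distrib]
  congr 1
  exact Finset.sum_congr rfl fun m _ => mul_comm _ _

/-- The terms with second derivatives of `A` are symmetric and cancel. This is also why the curl of
`w` is `C²` although `w` itself is only known to be `C²`. -/
theorem dirD_weber_antisymm (h : DiffusivePair S e₀ e ν U A v R) (hp : p ∈ S) (i j : Fin 3) :
    dirD S (e i) (fun y => ∑ m, dirD S (e j) (A m) y * v m y) p -
      dirD S (e j) (fun y => ∑ m, dirD S (e i) (A m) y * v m y) p =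
      stretch S e A v i j p - stretch S e A v j i p := by
  simp only [h.dirD_weber hp, h.ddA_comm hp _ j i]
  ring

/-- The contracted equation for `v` is differentiated along `e i`; its Leibniz term `∂ⱼ∂ₖ Aᵐ ∂ᵢ∂ₖ
vₘ` cancels the product-rule defect. The first two terms on the right are symmetric in `i, j`. -/
theorem transport_stretch (h : DiffusivePair S e₀ e ν U A v R) (hp : p ∈ S) (i j : Fin 3) :
    transport S e₀ e ν U (stretch S e A v i j) p =
      2 * ν * ∑ m, ∑ k, dirD S (e i) (dirD S (e j) (dirD S (e k) (A m))) p * dirD S (e k) (v m) p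
      - ∑ m, dirD S (e i) (dirD S (e j) (A m)) p * transport S e₀ e ν U (v m) p
      - ∑ l, dirD S (e i) (U l) p * stretch S e A v l j p
      - ∑ l, dirD S (e j) (U l) p * stretch S e A v i l p := by
  have hA1 := fun m => (h.contDiff_dA m j).of_le (m := 1) (by norm_num)
  have hv1 := fun m k => (h.contDiff_dv m k).of_le (m := 1) (by norm_num)
  have hAA := h.contDiff_ddA
  have h1 : dirD S (e i) (fun y => ∑ m, dirD S (e j) (A m) y * transport S e₀ e ν U (v m) y) p =
      2 * ν * ∑ m, ∑ k, (dirD S (e i) (dirD S (e j) (dirD S (e k) (A m))) p * dirD S (e k) (v m) p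
        + dirD S (e j) (dirD S (e k) (A m)) p * dirD S (e i) (dirD S (e k) (v m)) p) := by
    rw [dirD_congr (e i) (fun y hy => h.sum_dA_mul_transport_v hy j) hp,
      dirD_const_mul h.uniq _ _ (.sum fun m _ => .sum fun k _ => (hAA m k j).mul (hv1 m k)) hp,
      dirD_sum h.uniq _ _ (fun m => .sum fun k _ => (hAA m k j).mul (hv1 m k)) hp]
    congr 1
    refine Finset.sum_congr rfl fun m _ => ?_
    rw [dirD_sum h.uniq _ _ (fun k => (hAA m k j).mul (hv1 m k)) hp]
    exact Finset.sum_congr rfl fun k _ => dirD_mul h.uniq _ (hAA m k j) (hv1 m k) hp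
  rw [dirD_sum h.uniq _ _ (fun m => (hA1 m).mul (h.contDiff_transport_v m)) hp] at h1
  simp only [dirD_mul h.uniq _ (hA1 _) (h.contDiff_transport_v _) hp] at h1
  change transport S e₀ e ν U (fun y => ∑ m, dirD S (e i) (v m) y * dirD S (e j) (A m) y) p = _
  rw [transport_sum h.uniq _ (fun m => (h.contDiff_dv m i).mul (h.contDiff_dA m j)) hp]
  simp only [transport_mul h.uniq (h.contDiff_dv _ i) (h.contDiff_dA _ j) hp, h.transport_dA hp,
    h.transport_dv hp, stretch]
  simp only [h.ddA_comm hp _ j, h.ddv_comm hp _ i] at h1 ⊢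
  simp only [Fin.sum_univ_three] at h1 ⊢
  linear_combination h1

theorem transport_stretch_antisymm (h : DiffusivePair S e₀ e ν U A v R) (hp : p ∈ S)
    (i j : Fin 3) :
    transport S e₀ e ν U (fun y => stretch S e A v i j y - stretch S e A v j i y) p =
      -∑ l, dirD S (e i) (U l) p * (stretch S e A v l j p - stretch S e A v j l p)
      - ∑ l, dirD S (e j) (U l) p * (stretch S e A v i l p - stretch S e A v l i p) := by
  rw [transport_sub h.uniq (h.contDiff_stretch i j) (h.contDiff_stretch j i) hp]
  simp only [h.transport_stretch hp, h.ddA_comm hp _ i j,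
    dirD_comm h.uniq h.subset_closure (e j) (e i) (h.contDiff_dA _ _) hp, mul_sub,
    Finset.sum_sub_distrib]
  ring

/-- Differentiate `R ∇A = 1` and multiply by `R` on the right. -/
theorem dirD_R (h : DiffusivePair S e₀ e ν U A v R) (hp : p ∈ S) (k l i : Fin 3) :
    dirD S (e k) (R l i) p = -∑ n, R l n p * conn S e R A n k i p := by
  have hR := fun i m => (h.contDiff_R i m).of_le (m := 1) (by norm_num)
  have hA := fun m j => (h.contDiff_dA m j).of_le (m := 1) (by norm_num)
  have h1 : ∀ j, ∑ m, (dirD S (e k) (R l m) p * dirD S (e j) (A m) p +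
      R l m p * dirD S (e k) (dirD S (e j) (A m)) p) = 0 := by
    intro j
    have := dirD_congr (e k) (fun y hy => h.left_inv y hy l j) hp
    rw [dirD_const, dirD_sum h.uniq _ _ (fun m => (hR l m).mul (hA m j)) hp] at this
    simpa only [dirD_mul h.uniq _ (hR _ _) (hA _ _) hp] using this
  have h2 : dirD S (e k) (R l i) p =
      ∑ m, dirD S (e k) (R l m) p * ∑ j, dirD S (e j) (A m) p * R j i p := by
    simp [h.right_inv p hp]
  rw [h2]
  have h3 := h1 0
  have h4 := h1 1
  have h5 := h1 2
  simp only [conn, lagD, h.ddA_comm hp _ k, Fin.sum_univ_three] at h3 h4 h5 ⊢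
  linear_combination R 0 i p * h3 + R 1 i p * h4 + R 2 i p * h5

theorem contDiff_lagD_v (h : DiffusivePair S e₀ e ν U A v R) (i m : Fin 3) :
    ContDiffOn ℝ 2 (lagD S e R i (v m)) S :=
  .sum fun j _ => (h.contDiff_R j i).mul (h.contDiff_dv m j)

theorem dirD_lagD (h : DiffusivePair S e₀ e ν U A v R) (hF : ContDiffOn ℝ 2 F S) (hp : p ∈ S)
    (k i : Fin 3) :
    dirD S (e k) (lagD S e R i F) p =
      lagD S e R i (dirD S (e k) F) p - ∑ n, conn S e R A n k i p * lagD S e R n F p := by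
  have hR := fun i m => (h.contDiff_R i m).of_le (m := 1) (by norm_num)
  have hdF := fun j => contDiffOn_dirD (m := 1) h.uniq (e j) hF (by norm_num)
  change dirD S (e k) (fun y => ∑ j, R j i y * dirD S (e j) F y) p = _
  rw [dirD_sum h.uniq _ _ (fun j => (hR j i).mul (hdF j)) hp]
  simp only [dirD_mul h.uniq _ (hR _ _) (hdF _) hp, h.dirD_R hp,
    dirD_comm h.uniq h.subset_closure (e k) _ hF hp]
  simp only [lagD, Fin.sum_univ_three]
  ring

/-- The Eulerian-Lagrangian derivatives commute. -/
theorem lagD_comm (h : DiffusivePair S e₀ e ν U A v R) (hF : ContDiffOn ℝ 2 F S) (hp : p ∈ S)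
    (i j : Fin 3) :
    lagD S e R i (lagD S e R j F) p = lagD S e R j (lagD S e R i F) p := by
  -- The second `∇^A` derivative is a Hessian contracted with `R R`, minus the same expression for
  -- each `Aᵐ` times `∇^A_m F`. Symmetry in `i, j` is thus inherited from the Hessians.
  have h1 : ∀ i j, lagD S e R i (lagD S e R j F) p =
      ∑ l, ∑ n, R l i p * R n j p * dirD S (e n) (dirD S (e l) F) p -
        ∑ m, (∑ l, ∑ n, R l i p * R n j p * dirD S (e n) (dirD S (e l) (A m)) p) *
          lagD S e R m F p := by
    intro i j
    rw [lagD]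
    simp only [h.dirD_lagD hF hp, conn]
    simp only [lagD_dirD, Fin.sum_univ_three]
    ring
  have h2 : ∀ G, ContDiffOn ℝ 2 G S →
      ∑ l, ∑ n, R l i p * R n j p * dirD S (e n) (dirD S (e l) G) p =
        ∑ l, ∑ n, R l j p * R n i p * dirD S (e n) (dirD S (e l) G) p := by
    intro G hG
    rw [Finset.sum_comm]
    refine Finset.sum_congr rfl fun l _ => Finset.sum_congr rfl fun n _ => ?_
    rw [dirD_comm h.uniq h.subset_closure (e l) _ hG hp]
    ring
  rw [h1 i j, h1 j i, h2 F hF]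
  simp only [h2 _ ((h.contDiff_A _).of_le (m := 2) (by norm_num))]

theorem lagD_conn_comm (h : DiffusivePair S e₀ e ν U A v R) (hp : p ∈ S) (m k i j : Fin 3) :
    lagD S e R i (conn S e R A m k j) p = lagD S e R j (conn S e R A m k i) p :=
  h.lagD_comm (h.contDiff_dA m k) hp i j

theorem lagD_transport_v (h : DiffusivePair S e₀ e ν U A v R) (hp : p ∈ S) (i j : Fin 3) :
    lagD S e R i (transport S e₀ e ν U (v j)) p =
      2 * ν * ∑ m, ∑ k, (lagD S e R i (conn S e R A m k j) p * dirD S (e k) (v m) p +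
        conn S e R A m k j p * (dirD S (e k) (lagD S e R i (v m)) p +
          ∑ n, conn S e R A n k i p * lagD S e R n (v m) p)) := by
  have hC := h.contDiff_conn
  have hv1 := fun m k => (h.contDiff_dv m k).of_le (m := 1) (by norm_num)
  have h1 : ∀ l, dirD S (e l) (transport S e₀ e ν U (v j)) p =
      2 * ν * ∑ m, ∑ k, (dirD S (e l) (conn S e R A m k j) p * dirD S (e k) (v m) p +
        conn S e R A m k j p * dirD S (e l) (dirD S (e k) (v m)) p) := by
    intro l
    rw [dirD_congr (e l) (fun y hy => h.eq_v y hy j) hp,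
      dirD_const_mul h.uniq _ _ (.sum fun m _ => .sum fun k _ => (hC m k j).mul (hv1 m k)) hp,
      dirD_sum h.uniq _ _ (fun m => .sum fun k _ => (hC m k j).mul (hv1 m k)) hp]
    congr 1
    refine Finset.sum_congr rfl fun m _ => ?_
    rw [dirD_sum h.uniq _ _ (fun k => (hC m k j).mul (hv1 m k)) hp]
    exact Finset.sum_congr rfl fun k _ => dirD_mul h.uniq _ (hC m k j) (hv1 m k) hp
  -- The inner bracket becomes `∇^A_i ∂ₖ vₘ`, so only the Leibniz rule remains.
  simp only [h.dirD_lagD ((h.contDiff_v _).of_le (by norm_num)) hp, sub_add_cancel]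
  simp only [lagD, h1, Fin.sum_univ_three]
  ring

/-- Apply `Γ` to `∂ₗ = (∂ₗ Aᵐ) ∇^A_m`. The `∂ₗ U` terms cancel, and contracting the remaining defect
with `R` gives the commutator; no equation for `Γ R` is needed. -/
theorem transport_lagD_v (h : DiffusivePair S e₀ e ν U A v R) (hp : p ∈ S) (i j : Fin 3) :
    transport S e₀ e ν U (lagD S e R i (v j)) p =
      lagD S e R i (transport S e₀ e ν U (v j)) p +
        2 * ν * ∑ m, ∑ k, conn S e R A m k i p * dirD S (e k) (lagD S e R m (v j)) p := by
  have h1 : ∀ l, ∑ m, dirD S (e l) (A m) p * transport S e₀ e ν U (lagD S e R m (v j)) p =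
      dirD S (e l) (transport S e₀ e ν U (v j)) p + 2 * ν * ∑ m, ∑ k,
        dirD S (e l) (dirD S (e k) (A m)) p * dirD S (e k) (lagD S e R m (v j)) p := by
    intro l
    have h2 := transport_congr (e₀ := e₀) (e := e) (ν := ν) (U := U)
      (fun y hy => h.sum_dA_mul_lagD hy l (v j)) hp
    rw [h.transport_dv hp, transport_sum h.uniq _
      (fun m => (h.contDiff_dA m l).mul (h.contDiff_lagD_v m j)) hp] at h2
    simp only [transport_mul h.uniq (h.contDiff_dA _ l) (h.contDiff_lagD_v _ j) hp,
      h.transport_dA hp, h.ddA_comm hp _ l, ← h.sum_dA_mul_lagD hp _ (v j)] at h2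
    simp only [Fin.sum_univ_three] at h2 ⊢
    linear_combination h2
  have h3 : transport S e₀ e ν U (lagD S e R i (v j)) p =
      ∑ l, R l i p * ∑ m, dirD S (e l) (A m) p *
        transport S e₀ e ν U (lagD S e R m (v j)) p := by
    calc _ = ∑ m, (∑ l, dirD S (e l) (A m) p * R l i p) *
        transport S e₀ e ν U (lagD S e R m (v j)) p := by simp [h.right_inv p hp]
      _ = _ := by
        simp only [Fin.sum_univ_three]
        ring
  have h4 : lagD S e R i (transport S e₀ e ν U (v j)) p =
    ∑ l, R l i p * dirD S (e l) (transport S e₀ e ν U (v j)) p := rfl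
  rw [h3, h4]
  simp only [h1, conn, lagD_dirD, Fin.sum_univ_three]
  ring

theorem transport_lagD_v_antisymm (h : DiffusivePair S e₀ e ν U A v R) (hp : p ∈ S)
    (i j : Fin 3) :
    transport S e₀ e ν U (fun y => lagD S e R i (v j) y - lagD S e R j (v i) y) p =
      2 * ν * ∑ k, (∑ m, conn S e R A m k i p * (dirD S (e k) (lagD S e R m (v j)) p -
          dirD S (e k) (lagD S e R j (v m)) p) -
        ∑ m, conn S e R A m k j p * (dirD S (e k) (lagD S e R m (v i)) p -
          dirD S (e k) (lagD S e R i (v m)) p) +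
        ∑ m, ∑ n, conn S e R A m k j p * conn S e R A n k i p *
          (lagD S e R n (v m) p - lagD S e R m (v n) p)) := by
  rw [transport_sub h.uniq (h.contDiff_lagD_v i j) (h.contDiff_lagD_v j i) hp]
  simp only [h.transport_lagD_v hp, h.lagD_transport_v hp, h.lagD_conn_comm hp _ _ i j,
    Fin.sum_univ_three]
  ring

end DiffusivePair

end Fields

/-! ### Pointwise algebra of antisymmetric tensors in dimension three. -/

section Antisymmetric

theorem eq_zero_or_one_or_two (q : Fin 3) : q = 0 ∨ q = 1 ∨ q = 2 := by
  fin_cases q <;> simp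

/-- Index addition in `Fin 3` is modulo 3, so the two nonzero values of `eps q` sit at `(q+1, q+2)`
and its swap. -/
theorem sum_eps (q : Fin 3) (X : Fin 3 → Fin 3 → ℝ) :
    ∑ i, ∑ j, eps q i j * X i j = X (q + 1) (q + 2) - X (q + 2) (q + 1) := by
  obtain rfl | rfl | rfl := eq_zero_or_one_or_two q <;>
  · simp only [Fin.sum_univ_three, eps, Fin.val_zero, Fin.val_one, Fin.val_two, zero_add,
      Fin.reduceAdd, Nat.cast_zero, Nat.cast_one, Nat.cast_ofNat]
    ring

theorem det_rows (z x y : Fin 3 → ℝ) :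
    Matrix.det (Matrix.of ![z, x, y]) =
      ∑ i, z i * (x (i + 1) * y (i + 2) - x (i + 2) * y (i + 1)) := by
  simp [Matrix.det_fin_three, Fin.sum_univ_three]
  ring

/-- Transport of an antisymmetric tensor by a divergence free field acts as stretching on the dual
vector. -/
theorem stretching_of_trace_eq_zero (D T : Fin 3 → Fin 3 → ℝ) (hD : ∑ k, D k k = 0) (q : Fin 3) :
    -∑ l, D (q + 1) l * (T l (q + 2) - T (q + 2) l)
      - ∑ l, D (q + 2) l * (T (q + 1) l - T l (q + 1)) =
      ∑ j, D j q * (T (j + 1) (j + 2) - T (j + 2) (j + 1)) := by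
  simp only [Fin.sum_univ_three] at hD ⊢
  fin_cases q <;> simp
  -- The two sides differ by minus the trace of `D` times component `q` of the dual vector.
  · linear_combination -(T 1 2 - T 2 1) * hD
  · linear_combination -(T 2 0 - T 0 2) * hD
  · linear_combination -(T 0 1 - T 1 0) * hD

/-- Used for each fixed `k` with `M = C_k`, `N = ∂ₖ ∇^A v`, `G = ∇^A v`. The factor 2 arises because
exchanging `(j, r)` with `(i, m)` fixes the double `eps` sum, which therefore counts the quadratic
term twice. -/
theorem curl_connection_identity (M N G : Fin 3 → Fin 3 → ℝ) (q : Fin 3) :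
    2 * (∑ m, M m (q + 1) * (N m (q + 2) - N (q + 2) m) -
        ∑ m, M m (q + 2) * (N m (q + 1) - N (q + 1) m) +
        ∑ m, ∑ n, M m (q + 2) * M n (q + 1) * (G n m - G m n)) =
      2 * ∑ m, M m m * (N (q + 1) (q + 2) - N (q + 2) (q + 1))
      - 2 * ∑ j, M q j * (N (j + 1) (j + 2) - N (j + 2) (j + 1))
      + ∑ m, ∑ i, ∑ r, ∑ j, ∑ p, M m i * M r j * eps q j i * eps r m p *
          (G (p + 1) (p + 2) - G (p + 2) (p + 1)) := by
  have h : ∑ m, ∑ i, ∑ r, ∑ j, ∑ p, M m i * M r j * eps q j i * eps r m p *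
          (G (p + 1) (p + 2) - G (p + 2) (p + 1)) =
      ∑ r, ∑ m, ∑ p, eps r m p * ((G (p + 1) (p + 2) - G (p + 2) (p + 1)) *
        ∑ j, ∑ i, eps q j i * (M m i * M r j)) := by
    simp only [Fin.sum_univ_three]
    ring
  rw [h]
  simp only [sum_eps]
  obtain rfl | rfl | rfl := eq_zero_or_one_or_two q <;>
  · simp only [Fin.sum_univ_three, zero_add, Fin.reduceAdd]
    ring

/-- The Cauchy formula for the antisymmetric part of `Bᵀ G B`. -/
theorem cauchy_identity (B G : Fin 3 → Fin 3 → ℝ) (q : Fin 3) :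
    ∑ m, (∑ n, B n (q + 1) * G n m) * B m (q + 2) - ∑ m, (∑ n, B n (q + 2) * G n m) * B m (q + 1) =
      1 / 2 * ∑ i, ∑ j, eps q i j * Matrix.det (Matrix.of
        ![fun p => G (p + 1) (p + 2) - G (p + 2) (p + 1), fun p => B p i, fun p => B p j]) := by
  simp only [det_rows, sum_eps]
  obtain rfl | rfl | rfl := eq_zero_or_one_or_two q <;>
  · simp only [Fin.sum_univ_three, zero_add, Fin.reduceAdd]
    ring

end Antisymmetric

/-! ### Equations for the two curls and for the determinant. -/

namespace DiffusivePair

variable {V : Type*} [NormedAddCommGroup V] [NormedSpace ℝ V]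
  {S : Set V} {e₀ : V} {e : Fin 3 → V} {ν : ℝ} {U A v : Fin 3 → V → ℝ}
  {R : Fin 3 → Fin 3 → V → ℝ} {p : V}

/-- The equation for the curl of `(∇A)^* v`. -/
theorem transport_curl (h : DiffusivePair S e₀ e ν U A v R) (hp : p ∈ S) (q : Fin 3) :
    transport S e₀ e ν U (fun y => ∑ i, ∑ j, eps q i j * stretch S e A v i j y) p =
      ∑ j, dirD S (e j) (U q) p * ∑ i, ∑ l, eps j i l * stretch S e A v i l p := by
  simp only [sum_eps]
  rw [h.transport_stretch_antisymm hp]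
  exact stretching_of_trace_eq_zero (fun k l => dirD S (e k) (U l) p)
    (fun i l => stretch S e A v i l p) (h.div_eq p hp) q

/-- Since `∂ᵢ vₘ = (∂ᵢ Aⁿ) ∇^A_n vₘ`, the tensor `stretch` has the form `Bᵀ G B`. -/
theorem cauchy_formula (h : DiffusivePair S e₀ e ν U A v R) (hp : p ∈ S) (q : Fin 3) :
    ∑ i, ∑ j, eps q i j * stretch S e A v i j p =
      1 / 2 * ∑ i, ∑ j, eps q i j * Matrix.det (Matrix.of
        ![fun n => ∑ k, ∑ l, eps n k l * lagD S e R k (v l) p,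
          fun n => dirD S (e i) (A n) p, fun n => dirD S (e j) (A n) p]) := by
  simp only [sum_eps _ fun k l => lagD S e R k (v l) p]
  rw [← cauchy_identity (fun m j => dirD S (e j) (A m) p) (fun k l => lagD S e R k (v l) p), sum_eps]
  simp only [stretch, ← h.sum_dA_mul_lagD hp _ (v _)]

/-- The equation for the Eulerian-Lagrangian curl of `v`. -/
theorem transport_lagCurl (h : DiffusivePair S e₀ e ν U A v R) (hp : p ∈ S) (q : Fin 3) :
    transport S e₀ e ν U (fun y => ∑ i, ∑ j, eps q i j * lagD S e R i (v j) y) p =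
      2 * ν * ∑ m, ∑ k, conn S e R A m k m p *
        dirD S (e k) (fun y => ∑ i, ∑ j, eps q i j * lagD S e R i (v j) y) p
      - 2 * ν * ∑ n, ∑ k, conn S e R A q k n p *
        dirD S (e k) (fun y => ∑ i, ∑ j, eps n i j * lagD S e R i (v j) y) p
      + ν * ∑ m, ∑ k, ∑ i, ∑ r, ∑ j, ∑ n, conn S e R A m k i p * conn S e R A r k j p *
        eps q j i * eps r m n * ∑ a, ∑ b, eps n a b * lagD S e R a (v b) p := by
  have hG := fun i m => (h.contDiff_lagD_v i m).of_le (m := 1) (by norm_num)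
  have h1 : ∀ k q, dirD S (e k) (fun y => ∑ i, ∑ j, eps q i j * lagD S e R i (v j) y) p =
      dirD S (e k) (lagD S e R (q + 1) (v (q + 2))) p -
        dirD S (e k) (lagD S e R (q + 2) (v (q + 1))) p := by
    intro k q
    rw [← sum_eps q fun i j => dirD S (e k) (lagD S e R i (v j)) p,
      dirD_sum h.uniq _ _ (fun i => .sum fun j _ => contDiffOn_const.mul (hG i j)) hp]
    refine Finset.sum_congr rfl fun i _ => ?_
    rw [dirD_sum h.uniq _ _ (fun j => contDiffOn_const.mul (hG i j)) hp]
    exact Finset.sum_congr rfl fun j _ => dirD_const_mul h.uniq _ _ (hG i j) hp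
  simp only [h1]
  simp only [sum_eps _ fun k l => lagD S e R k (v l) _]
  have h2 := fun k => curl_connection_identity (fun m i => conn S e R A m k i p)
    (fun i m => dirD S (e k) (lagD S e R i (v m)) p) (fun i m => lagD S e R i (v m) p) q
  -- The factor 2 moves inside the sum over `k` to match the doubled algebraic identity.
  rw [h.transport_lagD_v_antisymm hp, mul_comm 2 ν, mul_assoc, Finset.mul_sum _ _ (2 : ℝ),
    Finset.sum_congr rfl fun k _ => h2 k,
    Finset.sum_comm (f := fun m k => conn S e R A m k m p * _),
    Finset.sum_comm (f := fun n k => conn S e R A q k n p * _),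
    Finset.sum_comm (f := fun m k => ∑ i, ∑ r, ∑ j, ∑ n,
      conn S e R A m k i p * conn S e R A r k j p * eps q j i * eps r m n * _)]
  simp only [Finset.sum_add_distrib, Finset.sum_sub_distrib, ← Finset.mul_sum]
  ring

/-- The gradient matrix of `A`. -/
def jacobian (S : Set V) (e : Fin 3 → V) (A : Fin 3 → V → ℝ) (p : V) : Matrix (Fin 3) (Fin 3) ℝ :=
  Matrix.of fun m j => dirD S (e j) (A m) p

theorem inv_mul_jacobian (h : DiffusivePair S e₀ e ν U A v R) (hp : p ∈ S) :
    Matrix.of (fun i m => R i m p) * jacobian S e A p = 1 := by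
  ext i j
  simp [Matrix.mul_apply, jacobian, Matrix.one_apply, h.left_inv p hp]

theorem det_jacobian_ne_zero (h : DiffusivePair S e₀ e ν U A v R) (hp : p ∈ S) :
    (jacobian S e A p).det ≠ 0 := by
  intro h0
  have := congrArg Matrix.det (h.inv_mul_jacobian hp)
  simp [h0] at this

theorem adjugate_jacobian (h : DiffusivePair S e₀ e ν U A v R) (hp : p ∈ S) (i m : Fin 3) :
    (jacobian S e A p).adjugate i m = (jacobian S e A p).det * R i m p := by
  have : (jacobian S e A p).adjugate =
      (jacobian S e A p).det • Matrix.of (fun i m => R i m p) := by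
    rw [← Matrix.one_mul (Matrix.adjugate _), ← h.inv_mul_jacobian hp, Matrix.mul_assoc,
      Matrix.mul_adjugate, Matrix.mul_smul, Matrix.mul_one]
  rw [this]
  rfl

theorem contDiff_det_jacobian (h : DiffusivePair S e₀ e ν U A v R) :
    ContDiffOn ℝ 2 (fun y => (jacobian S e A y).det) S := by
  have hA := h.contDiff_dA
  simp only [Matrix.det_fin_three, jacobian, Matrix.of_apply]
  fun_prop

/-- `Real.log` is `log |·|`, so nonvanishing suffices and the sign of the determinant is irrelevant.
-/
theorem contDiff_log_det_jacobian (h : DiffusivePair S e₀ e ν U A v R) :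
    ContDiffOn ℝ 2 (fun y => Real.log (jacobian S e A y).det) S :=
  h.contDiff_det_jacobian.log fun _ hy => h.det_jacobian_ne_zero hy

/-- Jacobi's formula. -/
theorem dirD_log_det (h : DiffusivePair S e₀ e ν U A v R) (hp : p ∈ S) (a : V) :
    dirD S a (fun y => Real.log (jacobian S e A y).det) p =
      ∑ i, ∑ m, R i m p * dirD S a (dirD S (e i) (A m)) p := by
  have hA := fun m j => (h.contDiff_dA m j).of_le (m := 1) (by norm_num)
  have h0 := h.det_jacobian_ne_zero hp
  rw [dirD_log h.uniq a (h.contDiff_det_jacobian.of_le (by norm_num)) hp h0, div_eq_iff h0]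
  have h1 : (∑ i, ∑ m, R i m p * dirD S a (dirD S (e i) (A m)) p) * (jacobian S e A p).det =
      ∑ i, ∑ m, (jacobian S e A p).adjugate i m * dirD S a (dirD S (e i) (A m)) p := by
    simp only [h.adjugate_jacobian hp, Fin.sum_univ_three]
    ring
  -- Expansion along column 0 with cyclic row indices makes the three summands alike, so one product
  -- rule `h3` serves all.
  have h2 : (fun y => (jacobian S e A y).det) = fun y => ∑ i, jacobian S e A y i 0 *
      (jacobian S e A y (i + 1) 1 * jacobian S e A y (i + 2) 2 +
        (-1) * (jacobian S e A y (i + 1) 2 * jacobian S e A y (i + 2) 1)) := by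
    funext y
    simp only [Matrix.det_fin_three, Fin.sum_univ_three, zero_add, Fin.reduceAdd]
    ring
  simp only [jacobian, Matrix.of_apply] at h2
  rw [h1, jacobian, Matrix.adjugate_fin_three]
  change dirD S a (fun y => (jacobian S e A y).det) p = _
  simp only [jacobian]
  rw [h2, dirD_sum h.uniq a _ (fun i => (hA _ _).mul (((hA _ _).mul (hA _ _)).add
    (contDiffOn_const.mul ((hA _ _).mul (hA _ _))))) hp]
  have h3 : ∀ i j k l m n, dirD S a (fun y => dirD S (e i) (A j) y *
      (dirD S (e k) (A (j + 1)) y * dirD S (e l) (A (j + 2)) y +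
        (-1) * (dirD S (e m) (A (j + 1)) y * dirD S (e n) (A (j + 2)) y))) p =
      dirD S a (dirD S (e i) (A j)) p *
        (dirD S (e k) (A (j + 1)) p * dirD S (e l) (A (j + 2)) p -
        (dirD S (e m) (A (j + 1)) p * dirD S (e n) (A (j + 2)) p)) +
      dirD S (e i) (A j) p * (dirD S a (dirD S (e k) (A (j + 1))) p * dirD S (e l) (A (j + 2)) p +
        dirD S (e k) (A (j + 1)) p * dirD S a (dirD S (e l) (A (j + 2))) p -
        (dirD S a (dirD S (e m) (A (j + 1))) p * dirD S (e n) (A (j + 2)) p +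
        dirD S (e m) (A (j + 1)) p * dirD S a (dirD S (e n) (A (j + 2))) p)) := by
    intro i j k l m n
    rw [dirD_mul h.uniq a (hA _ _) (((hA _ _).mul (hA _ _)).add
        (contDiffOn_const.mul ((hA _ _).mul (hA _ _)))) hp,
      dirD_add h.uniq a ((hA _ _).mul (hA _ _)) (contDiffOn_const.mul ((hA _ _).mul (hA _ _))) hp,
      dirD_const_mul h.uniq a _ ((hA _ _).mul (hA _ _)) hp,
      dirD_mul h.uniq a (hA _ _) (hA _ _) hp, dirD_mul h.uniq a (hA _ _) (hA _ _) hp]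
    ring
  simp only [h3]
  simp [Fin.sum_univ_three]
  ring

/-- The equation for the logarithm of the determinant. -/
theorem transport_log_det (h : DiffusivePair S e₀ e ν U A v R) (hp : p ∈ S) :
    transport S e₀ e ν U (fun y => Real.log (jacobian S e A y).det) p =
      ν * ∑ i, ∑ k, ∑ s, conn S e R A i k s p * conn S e R A s k i p := by
  have hR := fun i m => (h.contDiff_R i m).of_le (m := 1) (by norm_num)
  have h1 : ∀ k, dirD S (e k) (dirD S (e k) (fun y => Real.log (jacobian S e A y).det)) p =
      ∑ i, ∑ m, (dirD S (e k) (R i m) p * dirD S (e k) (dirD S (e i) (A m)) p +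
        R i m p * dirD S (e k) (dirD S (e k) (dirD S (e i) (A m))) p) := by
    intro k
    rw [dirD_congr (e k) (fun y hy => h.dirD_log_det hy (e k)) hp,
      dirD_sum h.uniq _ _ (fun i => .sum fun m _ => (hR i m).mul (h.contDiff_ddA m i k)) hp]
    refine Finset.sum_congr rfl fun i _ => ?_
    rw [dirD_sum h.uniq _ _ (fun m => (hR i m).mul (h.contDiff_ddA m i k)) hp]
    exact Finset.sum_congr rfl fun m _ => dirD_mul h.uniq _ (hR i m) (h.contDiff_ddA m i k) hp
  -- Contracting `Γ(∇A)` with the inverse leaves minus the divergence of `U`.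
  have h2 : ∑ i, ∑ m, R i m p * transport S e₀ e ν U (dirD S (e i) (A m)) p = 0 := by
    calc _ = -∑ i, ∑ k, dirD S (e i) (U k) p * ∑ m, dirD S (e k) (A m) p * R i m p := by
          simp only [h.transport_dA hp, Fin.sum_univ_three]
          ring
      _ = -∑ i, dirD S (e i) (U i) p := by
          simp [mul_comm _ (R _ _ p), h.left_inv p hp]
      _ = 0 := by rw [h.div_eq p hp, neg_zero]
  have h3 : ∑ k, ∑ i, ∑ m, dirD S (e k) (R i m) p * dirD S (e k) (dirD S (e i) (A m)) p =
      -∑ i, ∑ k, ∑ s, conn S e R A i k s p * conn S e R A s k i p := by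
    have h5 : ∀ m k n, conn S e R A m k n p =
        ∑ i, R i n p * dirD S (e k) (dirD S (e i) (A m)) p := by
      intro m k n
      rw [conn, lagD]
      exact Finset.sum_congr rfl fun i _ => by rw [h.ddA_comm hp]
    calc _ = -∑ i, ∑ k, ∑ s, conn S e R A i k s p *
          ∑ j, R j i p * dirD S (e k) (dirD S (e j) (A s)) p := by
          simp only [h.dirD_R hp, Fin.sum_univ_three]
          ring
      _ = _ := by simp only [← h5]
  -- By Jacobi's formula only the second spatial derivative also hits `R`, which gives the extra `-ν
  -- ∂ₖR · ∂ₖ∇A`.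
  have h4 : transport S e₀ e ν U (fun y => Real.log (jacobian S e A y).det) p =
      ∑ i, ∑ m, R i m p * transport S e₀ e ν U (dirD S (e i) (A m)) p -
      ν * ∑ k, ∑ i, ∑ m, dirD S (e k) (R i m) p * dirD S (e k) (dirD S (e i) (A m)) p := by
    simp only [transport, h1, h.dirD_log_det hp, Fin.sum_univ_three]
    ring
  rw [h4, h2, h3]
  ring

end DiffusivePair

/-! ### Translation between slab derivatives and the operators of the statement. -/

section SpaceTime

variable {J : Set ℝ} {t : ℝ} {x : E3} {F : ℝ × E3 → ℝ} {g : E3 → ℝ}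

/-- The region of space-time with times in `J`. -/
abbrev slab (J : Set ℝ) : Set (ℝ × E3) := J ×ˢ Set.univ

/-- The unit vector of the time axis. -/
abbrev timeDir : ℝ × E3 := (1, 0)

/-- The unit vectors of the space axes. -/
abbrev spaceDir (k : Fin 3) : ℝ × E3 := (0, EuclideanSpace.single k 1)

theorem uniqueDiffOn_slab (hJ : Convex ℝ J) (hJint : (interior J).Nonempty) :
    UniqueDiffOn ℝ (slab J) :=
  (uniqueDiffOn_convex hJ hJint).prod uniqueDiffOn_univ

theorem slab_subset_closure_interior (hJ : Convex ℝ J) (hJint : (interior J).Nonempty) :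
    slab J ⊆ closure (interior (slab J)) := by
  rw [interior_prod_eq, closure_prod_eq, interior_univ, closure_univ,
    hJ.closure_interior_eq_closure_of_nonempty_interior hJint]
  exact Set.prod_mono subset_closure subset_rfl

/-- Each time slice of the slab is all of space, so a derivative within the slab restricts to an
unrestricted spatial one, even at an endpoint time. -/
theorem hasFDerivAt_slice (ht : t ∈ J) (hF : ContDiffOn ℝ 1 F (slab J))
    (hg : ∀ y, g y = F (t, y)) :
    HasFDerivAt g ((fderivWithin ℝ F (slab J) (t, x)).comp (ContinuousLinearMap.inr ℝ ℝ E3)) x := by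
  have h1 := (hF.differentiableOn one_ne_zero (t, x) ⟨ht, trivial⟩).hasFDerivWithinAt
  have h2 : HasFDerivWithinAt (fun y : E3 => (t, y)) (ContinuousLinearMap.inr ℝ ℝ E3) Set.univ x :=
    (hasFDerivAt_prodMk_right t x).hasFDerivWithinAt
  rw [funext hg]
  exact (h1.comp x h2 fun y _ => ⟨ht, trivial⟩).hasFDerivAt Filter.univ_mem

theorem pd_eq_dirD (ht : t ∈ J) (hF : ContDiffOn ℝ 1 F (slab J)) (hg : ∀ y, g y = F (t, y))
    (k : Fin 3) : pd k g x = dirD (slab J) (spaceDir k) F (t, x) := by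
  rw [pd, (hasFDerivAt_slice ht hF hg).fderiv]
  rfl

theorem derivWithin_eq_dirD (hJ : UniqueDiffOn ℝ J) (ht : t ∈ J) (hF : ContDiffOn ℝ 1 F (slab J))
    {f : ℝ → ℝ} (hf : ∀ s ∈ J, f s = F (s, x)) :
    derivWithin f J t = dirD (slab J) timeDir F (t, x) := by
  have h1 := (hF.differentiableOn one_ne_zero (t, x) ⟨ht, trivial⟩).hasFDerivWithinAt
  have h2 : HasDerivWithinAt (fun s : ℝ => (s, x)) ((1 : ℝ), (0 : E3)) J t :=
    (hasDerivWithinAt_id t J).prodMk (hasDerivWithinAt_const t J x)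
  rw [derivWithin_congr hf (hf t ht)]
  have h3 : Set.MapsTo (fun s : ℝ => (s, x)) J (slab J) := fun s hs => ⟨hs, trivial⟩
  exact (h1.comp_hasDerivWithinAt t h2 h3).derivWithin (hJ t ht)

theorem laplacian_eq_sum_pd (hg : ContDiff ℝ 2 g) : (Δ g) x = ∑ k, pd k (pd k g) x := by
  rw [InnerProductSpace.laplacian_eq_iteratedFDeriv_orthonormalBasis g
    (EuclideanSpace.basisFun (Fin 3) ℝ)]
  refine Finset.sum_congr rfl fun k _ => ?_
  have hd : DifferentiableAt ℝ (fderiv ℝ g) x :=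
    (hg.fderiv_right (m := 1) (by norm_num)).differentiable one_ne_zero x
  have h := fderiv_clm_apply hd (differentiableAt_const (EuclideanSpace.single k (1 : ℝ)))
  change _ = fderiv ℝ (fun y => fderiv ℝ g y (EuclideanSpace.single k 1)) x _
  rw [h, iteratedFDeriv_two_apply]
  simp

theorem laplacian_eq_dirD (hJ : UniqueDiffOn ℝ (slab J)) (ht : t ∈ J)
    (hF : ContDiffOn ℝ 2 F (slab J)) (hg : ∀ y, g y = F (t, y)) :
    (Δ g) x = ∑ k, dirD (slab J) (spaceDir k) (dirD (slab J) (spaceDir k) F) (t, x) := by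
  have hF1 := hF.of_le (m := 1) (by norm_num)
  have hg2 : ContDiff ℝ 2 g := by
    rw [funext hg, ← contDiffOn_univ]
    exact hF.comp (contDiff_prodMk_right t).contDiffOn fun y _ => ⟨ht, trivial⟩
  rw [laplacian_eq_sum_pd hg2]
  exact Finset.sum_congr rfl fun k _ => pd_eq_dirD ht (contDiffOn_dirD hJ _ hF (by norm_num))
    (fun y => pd_eq_dirD ht hF1 hg k) k

/-- Agreement of `f` and `F` is asked only for times in `J`, which is all that `derivWithin` sees.
-/
theorem Gam_eq_transport (hJ : Convex ℝ J) (hJint : (interior J).Nonempty) (ν : ℝ)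
    (u : ℝ → E3 → E3) {f : ℝ → E3 → ℝ} (ht : t ∈ J) (hF : ContDiffOn ℝ 2 F (slab J))
    (hf : ∀ s ∈ J, ∀ y, f s y = F (s, y)) :
    Gam J ν u f t x = transport (slab J) timeDir spaceDir ν (fun k p => u p.1 p.2 k) F (t, x) := by
  have hF1 := hF.of_le (m := 1) (by norm_num)
  rw [Gam, transport, derivWithin_eq_dirD (uniqueDiffOn_convex hJ hJint) ht hF1
      fun s hs => hf s hs x, laplacian_eq_dirD (uniqueDiffOn_slab hJ hJint) ht hF (hf t ht)]
  simp only [pd_eq_dirD ht hF1 (hf t ht)]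

theorem contDiffOn_coord {n : WithTop ℕ∞} {f : ℝ × E3 → E3} {S : Set (ℝ × E3)}
    (hf : ContDiffOn ℝ n f S) (k : Fin 3) : ContDiffOn ℝ n (fun p => f p k) S :=
  contDiffOn_euclidean.1 hf k

end SpaceTime

end

end DiffusiveLagrangian

/-! ### The theorem, transferred from the slab. -/

open DiffusiveLagrangian in
theorem theorem6
    (J : Set ℝ) (hJ : Convex ℝ J) (hJint : (interior J).Nonempty)
    (ν : ℝ) (hν : 0 ≤ ν)
    (u A v : ℝ → E3 → E3)
    (hu : ContDiffOn ℝ 1 (fun p : ℝ × E3 => u p.1 p.2) (J ×ˢ Set.univ))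
    (hA : ContDiffOn ℝ 3 (fun p : ℝ × E3 => A p.1 p.2) (J ×ˢ Set.univ))
    (hv : ContDiffOn ℝ 3 (fun p : ℝ × E3 => v p.1 p.2) (J ×ˢ Set.univ))
    (hdiv : ∀ t ∈ J, ∀ x, divergence (u t) x = 0)
    (hinv : ∀ t ∈ J, ∀ x, (grad (A t) x).det ≠ 0)
    (hAeq : ∀ t ∈ J, ∀ x, ∀ m, Gam J ν u (fun s y => A s y m) t x = 0)
    (hveq : ∀ t ∈ J, ∀ x, ∀ i, Gam J ν u (fun s y => v s y i) t x =
      2 * ν * ∑ m, ∑ k, C (A t) m k i x * pd k (fun y => v t y m) x) :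
    -- the fields below are of class `C²`, so that the equations hold in the classical sense
    (ContDiffOn ℝ 2 (fun p : ℝ × E3 => weber (A p.1) (v p.1) p.2) (J ×ˢ Set.univ) ∧
      ContDiffOn ℝ 2 (fun p : ℝ × E3 => curl (weber (A p.1) (v p.1)) p.2) (J ×ˢ Set.univ) ∧
      ContDiffOn ℝ 2 (fun p : ℝ × E3 => curlA (A p.1) (v p.1) p.2) (J ×ˢ Set.univ) ∧
      ContDiffOn ℝ 2 (fun p : ℝ × E3 => Real.log (grad (A p.1) p.2).det) (J ×ˢ Set.univ)) ∧
    -- the cotangent equation for `w`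
    (∀ t ∈ J, ∀ x, ∀ i,
      Gam J ν u (fun s y => weber (A s) (v s) y i) t x +
        ((grad (u t) x)ᵀ *ᵥ (weber (A t) (v t) x).ofLp) i = 0) ∧
    -- the equation for the Eulerian curl of `w`
    (∀ t ∈ J, ∀ x, ∀ q,
      Gam J ν u (fun s y => curl (weber (A s) (v s)) y q) t x =
        (grad (u t) x *ᵥ (curl (weber (A t) (v t)) x).ofLp) q) ∧
    -- the equation for the Eulerian-Lagrangian curl `ζ` of `v`
    (∀ t ∈ J, ∀ x, ∀ q,
      Gam J ν u (fun s y => curlA (A s) (v s) y q) t x =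
        2 * ν * ∑ m, ∑ k, C (A t) m k m x * pd k (fun y => curlA (A t) (v t) y q) x
        - 2 * ν * ∑ j, ∑ k, C (A t) q k j x * pd k (fun y => curlA (A t) (v t) y j) x
        + ν * ∑ m, ∑ k, ∑ i, ∑ r, ∑ j, ∑ p,
            C (A t) m k i x * C (A t) r k j x * eps q j i * eps r m p *
              curlA (A t) (v t) x p) ∧
    -- the Cauchy formula
    (∀ t ∈ J, ∀ x, ∀ q,
      curl (weber (A t) (v t)) x q =
        1 / 2 * ∑ i, ∑ j, eps q i j * detCauchy (A t) (curlA (A t) (v t) x) i j x) ∧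
    -- the equation for the logarithm of the determinant
    (∀ t ∈ J, ∀ x,
      Gam J ν u (fun s y => Real.log (grad (A s) y).det) t x =
        ν * ∑ i, ∑ k, ∑ s, C (A t) i k s x * C (A t) s k i x) := by
  let S := slab J
  let U : Fin 3 → ℝ × E3 → ℝ := fun k p => u p.1 p.2 k
  let a : Fin 3 → ℝ × E3 → ℝ := fun k p => A p.1 p.2 k
  let b : Fin 3 → ℝ × E3 → ℝ := fun k p => v p.1 p.2 k
  let R : Fin 3 → Fin 3 → ℝ × E3 → ℝ := fun i m p => Q (A p.1) p.2 i m
  have hS : UniqueDiffOn ℝ S := uniqueDiffOn_slab hJ hJint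
  have hU : ∀ k, ContDiffOn ℝ 1 (U k) S := contDiffOn_coord hu
  have ha : ∀ k, ContDiffOn ℝ 3 (a k) S := contDiffOn_coord hA
  have hb : ∀ k, ContDiffOn ℝ 3 (b k) S := contDiffOn_coord hv
  have ha1 : ∀ k, ContDiffOn ℝ 1 (a k) S := fun k => (ha k).of_le (by norm_num)
  have ha2 : ∀ k, ContDiffOn ℝ 2 (a k) S := fun k => (ha k).of_le (by norm_num)
  have hb1 : ∀ k, ContDiffOn ℝ 1 (b k) S := fun k => (hb k).of_le (by norm_num)
  have hb2 : ∀ k, ContDiffOn ℝ 2 (b k) S := fun k => (hb k).of_le (by norm_num)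
  have hda : ∀ m j, ContDiffOn ℝ 2 (dirD S (spaceDir j) (a m)) S :=
    fun m j => contDiffOn_dirD hS _ (ha m) (by norm_num)
  have hda1 : ∀ m j, ContDiffOn ℝ 1 (dirD S (spaceDir j) (a m)) S :=
    fun m j => (hda m j).of_le (by norm_num)
  have pdu : ∀ t ∈ J, ∀ x, ∀ m j, pd j (fun y => u t y m) x = dirD S (spaceDir j) (U m) (t, x) :=
    fun t ht x m j => pd_eq_dirD ht (hU m) (fun _ => rfl) j
  have pda : ∀ t ∈ J, ∀ x, ∀ m j, pd j (fun y => A t y m) x = dirD S (spaceDir j) (a m) (t, x) :=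
    fun t ht x m j => pd_eq_dirD ht (ha1 m) (fun _ => rfl) j
  have pdv : ∀ t ∈ J, ∀ x, ∀ m j, pd j (fun y => v t y m) x = dirD S (spaceDir j) (b m) (t, x) :=
    fun t ht x m j => pd_eq_dirD ht (hb1 m) (fun _ => rfl) j
  have hgrad : ∀ t ∈ J, ∀ x, grad (A t) x = DiffusivePair.jacobian S spaceDir a (t, x) := by
    intro t ht x
    ext m j
    exact pda t ht x m j
  have hdet : ContDiffOn ℝ 2 (fun p => (DiffusivePair.jacobian S spaceDir a p).det) S := by
    simp only [Matrix.det_fin_three, DiffusivePair.jacobian, Matrix.of_apply]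
    fun_prop
  have hR : ∀ i m, ContDiffOn ℝ 2 (R i m) S := by
    intro i m
    have h1 : ContDiffOn ℝ 2 (fun p => (DiffusivePair.jacobian S spaceDir a p).adjugate i m) S := by
      simp only [Matrix.adjugate_fin_three, DiffusivePair.jacobian, Matrix.of_apply]
      fin_cases i <;> fin_cases m <;> simp <;> fun_prop
    have h0 : ∀ p ∈ S, (DiffusivePair.jacobian S spaceDir a p).det ≠ 0 := by
      intro p hp
      rw [← hgrad p.1 hp.1 p.2]
      exact hinv p.1 hp.1 p.2
    -- The inverse is the adjugate over the determinant, both polynomial in `C²` entries.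
    refine ((hdet.inv h0).mul h1).congr fun p hp => ?_
    simp only [R, Q, hgrad p.1 hp.1 p.2, Matrix.inv_def, Ring.inverse_eq_inv']
    rfl
  have hC : ∀ t ∈ J, ∀ x, ∀ m k i, C (A t) m k i x = conn S spaceDir R a m k i (t, x) := by
    intro t ht x m k i
    -- `∂ₖ ℓₘ` and `∂ₖ Aₘ` differ by the constant `δ_{mk}`, so they define the same `C`.
    have h1 : ∀ y, pd k (fun y => (A t y - y) m) y =
        dirD S (spaceDir k) (a m) (t, y) - (if m = k then 1 else 0) := by
      intro y
      have h2 := hasFDerivAt_slice (x := y) ht (ha1 m) (fun _ => rfl)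
      have h3 : HasFDerivAt (fun y : E3 => y m) (EuclideanSpace.proj m : E3 →L[ℝ] ℝ) y :=
        (EuclideanSpace.proj m : E3 →L[ℝ] ℝ).hasFDerivAt
      rw [pd, (show HasFDerivAt (fun y => (A t y - y) m) _ y from h2.sub h3).fderiv]
      simp [dirD, S, slab]
    rw [C, pdA, conn, lagD]
    refine Finset.sum_congr rfl fun j _ => ?_
    rw [pd_eq_dirD ht ((hda1 m k).sub contDiffOn_const) h1]
    congr 1
    simp only [sub_eq_add_neg]
    rw [dirD_add hS _ (hda1 m k) contDiffOn_const ⟨ht, trivial⟩, dirD_const, add_zero]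
  have H : DiffusivePair S timeDir spaceDir ν U a b R := by
    refine ⟨hS, slab_subset_closure_interior hJ hJint, hU, ha, hb, hR, ?_, ?_, ?_, ?_, ?_⟩
    · rintro ⟨t, x⟩ ⟨ht, -⟩ i j
      have h1 := Matrix.nonsing_inv_mul _ (isUnit_iff_ne_zero.2 (hinv t ht x))
      have h2 := congrFun (congrFun h1 i) j
      rw [Matrix.mul_apply, Matrix.one_apply] at h2
      simp only [← pda t ht x]
      exact h2
    · rintro ⟨t, x⟩ ⟨ht, -⟩ i j
      have h1 := Matrix.mul_nonsing_inv _ (isUnit_iff_ne_zero.2 (hinv t ht x))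
      have h2 := congrFun (congrFun h1 i) j
      rw [Matrix.mul_apply, Matrix.one_apply] at h2
      simp only [← pda t ht x]
      exact h2
    · rintro ⟨t, x⟩ ⟨ht, -⟩
      have h1 := hdiv t ht x
      simpa only [divergence, pdu t ht x] using h1
    · rintro ⟨t, x⟩ ⟨ht, -⟩ m
      rw [← hAeq t ht x m, Gam_eq_transport hJ hJint ν u ht (ha2 m) fun _ _ _ => rfl]
    · rintro ⟨t, x⟩ ⟨ht, -⟩ i
      have h1 := hveq t ht x i
      rw [Gam_eq_transport hJ hJint ν u ht (hb2 i) fun _ _ _ => rfl] at h1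
      simpa only [hC t ht x, pdv t ht x] using h1
  let w : Fin 3 → ℝ × E3 → ℝ := fun i p => ∑ m, dirD S (spaceDir i) (a m) p * b m p
  let curlw : Fin 3 → ℝ × E3 → ℝ :=
    fun q p => ∑ i, ∑ j, eps q i j * DiffusivePair.stretch S spaceDir a b i j p
  let ζ : Fin 3 → ℝ × E3 → ℝ :=
    fun q p => ∑ i, ∑ j, eps q i j * lagD S spaceDir R i (b j) p
  have cw : ∀ i, ContDiffOn ℝ 2 (w i) S := fun i => .sum fun m _ => (hda m i).mul (hb2 m)
  have ccurlw : ∀ q, ContDiffOn ℝ 2 (curlw q) S := fun q =>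
    .sum fun i _ => .sum fun j _ => contDiffOn_const.mul (H.contDiff_stretch i j)
  have cζ : ∀ q, ContDiffOn ℝ 2 (ζ q) S := fun q =>
    .sum fun i _ => .sum fun j _ => contDiffOn_const.mul (H.contDiff_lagD_v i j)
  have ew : ∀ t ∈ J, ∀ x, ∀ i, weber (A t) (v t) x i = w i (t, x) := by
    intro t ht x i
    simp only [weber, pda t ht x]
    rfl
  have ecurlw : ∀ t ∈ J, ∀ x, ∀ q, curl (weber (A t) (v t)) x q = curlw q (t, x) := by
    intro t ht x q
    simp only [curl, curlw, pd_eq_dirD ht ((cw _).of_le (by norm_num)) (ew t ht · _), sum_eps]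
    exact H.dirD_weber_antisymm ⟨ht, trivial⟩ _ _
  have eζ : ∀ t ∈ J, ∀ x, ∀ q, curlA (A t) (v t) x q = ζ q (t, x) := by
    intro t ht x q
    simp only [curlA, ζ, pdA, pdv t ht x]
    rfl
  have pdζ : ∀ t ∈ J, ∀ x, ∀ q k, pd k (fun y => curlA (A t) (v t) y q) x =
      dirD S (spaceDir k) (ζ q) (t, x) := fun t ht x q k =>
    pd_eq_dirD ht ((cζ q).of_le (by norm_num)) (eζ t ht · q) k
  refine ⟨⟨?_, ?_, ?_, ?_⟩, ?_, ?_, ?_, ?_, ?_⟩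
  · exact contDiffOn_euclidean.2 fun i => (cw i).congr fun p hp => ew p.1 hp.1 p.2 i
  · exact contDiffOn_euclidean.2 fun i => (ccurlw i).congr fun p hp => ecurlw p.1 hp.1 p.2 i
  · exact contDiffOn_euclidean.2 fun i => (cζ i).congr fun p hp => eζ p.1 hp.1 p.2 i
  · refine H.contDiff_log_det_jacobian.congr fun p hp => ?_
    rw [hgrad p.1 hp.1 p.2]
  · intro t ht x i
    rw [Gam_eq_transport hJ hJint ν u ht (cw i) fun s hs y => ew s hs y i,
      ← H.transport_weber (p := (t, x)) ⟨ht, trivial⟩ i]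
    simp only [Matrix.mulVec, dotProduct, Matrix.transpose_apply, grad, Matrix.of_apply,
      pdu t ht x, ew t ht x]
    rfl
  · intro t ht x q
    rw [Gam_eq_transport hJ hJint ν u ht (ccurlw q) fun s hs y => ecurlw s hs y q]
    simp only [Matrix.mulVec, dotProduct, grad, Matrix.of_apply, pdu t ht x, ecurlw t ht x]
    exact H.transport_curl ⟨ht, trivial⟩ q
  · intro t ht x q
    rw [Gam_eq_transport hJ hJint ν u ht (cζ q) fun s hs y => eζ s hs y q]
    simp only [pdζ t ht x, eζ t ht x, hC t ht x]
    exact H.transport_lagCurl ⟨ht, trivial⟩ q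
  · intro t ht x q
    rw [ecurlw t ht x q]
    simp only [detCauchy, eζ t ht x, pda t ht x]
    exact H.cauchy_formula ⟨ht, trivial⟩ q
  · intro t ht x
    rw [Gam_eq_transport hJ hJint ν u ht H.contDiff_log_det_jacobian fun s hs y => by
      rw [hgrad s hs y]]
    simp only [hC t ht x]
    exact H.transport_log_det ⟨ht, trivial⟩
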